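/- For a nonempty set $S\subseteq[N]=\{1,\dots,N\}$ write $|S\rangle=\frac{1}{\sqrt{|S|}}\sum_{i\in S}|i\rangle$, let $\mathcal R_S=\mathbb 1-2|S\rangle\langle S|$ be the reflection about $|S\rangle$, and let $\mathcal O_S$ be the membership oracle, i.e. the unitary $\mathcal O_S|i\rangle|b\rangle=(1-2bx_i)|i\rangle|b\rangle$ for $i\in[N]$, $b\in\{0,1\}$, where $x_i=1$ if $i\in S$ and $x_i=0$ otherwise. Consider a quantum algorithm $Q$ that starts with $R_1$ copies of $|S\rangle$ together with a fixed finite-dimensional ancilla state independent of $S$, then applies a fixed sequence of gates, each of which is a unitary independent of $S$, an application of $\mathcal O_S$, or an application of $\mathcal R_S$, and finally measures in the computational basis and accepts if the outcome lies in a fixed set. Suppose that $Q$ applies $\mathcal O_S$ exactly $T$ times and $\mathcal R_S$ exactly $R_2$ times, and let $R=R_1+R_2$. **Theorem.** For every constant $p>\frac12$ there is a constant $c>0$, depending only on $p$, such that the following holds for all integers $w\ge 1$ and $N\ge 2w$. If $Q$ decides with success probability at least $p$ whether $|S|=w$ or $|S|=2w$, promised that one of these is the case (that is, $Q$ rejects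 with probability at least $p$ for every $S\subseteq[N]$ with $|S|=w$ and accepts with probability at least $p$ for every $S\subseteq[N]$ with $|S|=2w$), then $$T\ \ge\ c\,\sqrt{\frac Nw}\qquad\text{or}\qquad R\ \ge\ c\,\min\left\{w^{1/3},\sqrt{\frac Nw}\right\}.$$ -/

import Mathlib

open scoped Kronecker

/-- The amplitude vector of the state `|S⟩ = |S|^{-1/2} ∑_{i ∈ S} |i⟩` (for nonempty `S`). -/
noncomputable def ketS {N : ℕ} (S : Finset (Fin N)) : Fin N → ℂ :=
  fun i => if i ∈ S then ((1 / √(S.card : ℝ) : ℝ) : ℂ) else 0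

/-- The membership oracle `O_S |i⟩|b⟩ = (1 - 2 b x_i) |i⟩|b⟩`, with `x_i = 1` if `i ∈ S`
and `x_i = 0` otherwise. -/
def membershipOracle {N : ℕ} (S : Finset (Fin N)) : Matrix (Fin N × Bool) (Fin N × Bool) ℂ :=
  Matrix.diagonal fun q => 1 - 2 * (if q.2 then 1 else 0) * (if q.1 ∈ S then 1 else 0)

/-- The reflection `R_S = 1 - 2 |S⟩⟨S|` about `|S⟩`. -/
noncomputable def reflectionS {N : ℕ} (S : Finset (Fin N)) : Matrix (Fin N) (Fin N) ℂ :=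
  1 - (2 : ℂ) • Matrix.vecMulVec (ketS S) (star (ketS S))

/-- The computational basis of a machine with `r` registers holding the given copies of `|S⟩`,
an index register and a bit register (on which the oracles act), and an `m`-dimensional
workspace. -/
abbrev BasisIdx (N r m : ℕ) : Type := (Fin r → Fin N) × ((Fin N × Bool) × Fin m)

/-- The gates of a circuit: an arbitrary unitary on the whole space that does not depend on `S`,
one membership query, or one reflection about `|S⟩`. -/
inductive Gate (N r m : ℕ) : Type where
  | free (U : Matrix.unitaryGroup (BasisIdx N r m) ℂ) : Gate N r m
  | query : Gate N r m
  | reflect : Gate N r m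

/-- The operator that a gate applies when the hidden set is `S`. A query acts on the index and
bit registers, a reflection on the index register; both act as the identity elsewhere. -/
noncomputable def Gate.toMatrix {N r m : ℕ} (S : Finset (Fin N)) :
    Gate N r m → Matrix (BasisIdx N r m) (BasisIdx N r m) ℂ
  | .free U => (U : Matrix (BasisIdx N r m) (BasisIdx N r m) ℂ)
  | .query => (1 : Matrix (Fin r → Fin N) (Fin r → Fin N) ℂ) ⊗ₖ
      (membershipOracle S ⊗ₖ (1 : Matrix (Fin m) (Fin m) ℂ))
  | .reflect => (1 : Matrix (Fin r → Fin N) (Fin r → Fin N) ℂ) ⊗ₖ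
      ((reflectionS S ⊗ₖ (1 : Matrix Bool Bool ℂ)) ⊗ₖ (1 : Matrix (Fin m) (Fin m) ℂ))

/-- `1` for a membership query, `0` for any other gate. -/
def Gate.queryCost {N r m : ℕ} : Gate N r m → ℕ
  | .query => 1
  | _ => 0

/-- `1` for a reflection about `|S⟩`, `0` for any other gate. -/
def Gate.reflectCost {N r m : ℕ} : Gate N r m → ℕ
  | .reflect => 1
  | _ => 0

/-- A quantum algorithm with access to a hidden `S ⊆ [N]` through membership queries, copies of
`|S⟩` and reflections about `|S⟩`. Nothing in it depends on `S`. -/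
structure QAlgorithm (N : ℕ) where
  /-- the number of copies of `|S⟩` it receives -/
  copies : ℕ
  /-- the dimension of its workspace -/
  workDim : ℕ
  /-- the basis state in which the index, bit and workspace registers start -/
  init : (Fin N × Bool) × Fin workDim
  /-- the gates, in the order in which they are applied -/
  gates : List (Gate N copies workDim)
  /-- the outcomes of the final computational-basis measurement on which it accepts -/
  accept : Finset (BasisIdx N copies workDim)

namespace QAlgorithm

variable {N : ℕ} (Q : QAlgorithm N)

/-- The number of membership queries. -/
def queries : ℕ := (Q.gates.map Gate.queryCost).sum

/-- The number of reflections about `|S⟩`. -/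
def reflections : ℕ := (Q.gates.map Gate.reflectCost).sum

/-- The initial state `|S⟩^{⊗ copies} ⊗ |init⟩`. -/
noncomputable def initialState (S : Finset (Fin N)) : BasisIdx N Q.copies Q.workDim → ℂ :=
  fun z => (∏ k, ketS S (z.1 k)) * (if z.2 = Q.init then 1 else 0)

/-- The state after all gates have been applied in order. -/
noncomputable def finalState (S : Finset (Fin N)) : BasisIdx N Q.copies Q.workDim → ℂ :=
  Q.gates.foldl (fun ψ g => (g.toMatrix S).mulVec ψ) (Q.initialState S)

/-- The probability that the final measurement gives an accepting outcome. -/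
noncomputable def acceptProb (S : Finset (Fin N)) : ℝ :=
  ∑ z ∈ Q.accept, ‖Q.finalState S z‖ ^ 2

/-- `Q` decides with success probability at least `p` whether `|S| = w` (then it should reject)
or `|S| = 2w` (then it should accept), under the promise that one of these holds. -/
def Decides (w : ℕ) (p : ℝ) : Prop :=
  (∀ S : Finset (Fin N), S.card = w → p ≤ 1 - Q.acceptProb S) ∧
  (∀ S : Finset (Fin N), S.card = 2 * w → p ≤ Q.acceptProb S)

end QAlgorithm

/-! The proof is by the polynomial method with Laurent polynomials. Entries of a query are affine in
the membership indicators of `S`. Entries of a reflection become quadratic after multiplication by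
`|S|`, and each copy of `|S⟩` costs a factor `√|S|`. Averaging the acceptance probability over all
`S` of size `k` therefore gives `q(k) = P(k) / k ^ E` with `E = 2R` and `deg P ≤ E + D`, where `D =
2T + 2R` (`exists_polynomial_meanAcceptProb`). Moreover `q` lies in `[0, 1]` at every integer `1 ≤ k
≤ N`.

Such a `q` cannot jump between `w` and `2w` (`laurent_sub_le`). A divided difference over `E + D +
2` nodes kills every polynomial of degree at most `E + D`; applied to `P - q(2w) X ^ E`, it bounds
`q(2w) - q(w)` by the total relative weight of the other `E + D` nodes (`sub_le_sum_of_laurent`).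
These are `D` high nodes `C i² w` and `E` low nodes near `2E³ / i²`, so the high nodes in the
variable `k` and the low nodes in `1 / k` are spaced quadratically. At quadratic spacing the
products of gap ratios are at most 2, and the weights sum to at most `8 E³ / w + 8 / C`.

The high nodes fit below `N` when `D` is small against `√(N / w)`. The low nodes are distinct
integers because their gaps, about `E³ / i³`, stay of order at least 1 up to `i = E`; they weigh
little when `E` is small against `w^{1/3}`. Hence small `T` and `R` leave a gap smaller than `2p -
1`. -/

/-! ### Products of gap ratios at quadratically spaced nodes -/

section FactorialProducts

open scoped Nat

theorem prod_sq_div_abs_sq_sub_sq_of_lt {m n : ℕ} (h : n < m) :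
    ∏ j ∈ Finset.Icc 1 n, (j : ℝ) ^ 2 / |(j : ℝ) ^ 2 - (m : ℝ) ^ 2| =
      (n ! : ℝ) ^ 2 * (m - n - 1)! * m / (m + n)! := by
  induction n with
  | zero =>
    obtain ⟨k, rfl⟩ : ∃ k, m = k + 1 := ⟨m - 1, by omega⟩
    have : ((k + 1)! : ℝ) ≠ 0 := by positivity
    simp only [zero_lt_one, Finset.Icc_eq_empty_of_lt, Finset.prod_empty, Nat.factorial_zero,
      Nat.cast_one, one_pow, one_mul, Nat.sub_zero, Nat.add_sub_cancel, add_zero]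
    rw [eq_div_iff this, Nat.factorial_succ]
    push_cast; ring
  | succ n ih =>
    rw [Finset.prod_Icc_succ_top (by omega), ih (by omega)]
    obtain ⟨k, rfl⟩ : ∃ k, m = n + 2 + k := ⟨m - (n + 2), by omega⟩
    have e1 : n + 2 + k - n - 1 = k + 1 := by omega
    have e2 : n + 2 + k - (n + 1) - 1 = k := by omega
    have e3 : |((n + 1 : ℕ) : ℝ) ^ 2 - ((n + 2 + k : ℕ) : ℝ) ^ 2| =
        (k + 1) * (2 * n + 3 + k) := by
      rw [abs_of_nonpos] <;> push_cast <;> [ring; nlinarith [(Nat.cast_nonneg n : (0 : ℝ) ≤ n),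
        (Nat.cast_nonneg k : (0 : ℝ) ≤ k), mul_nonneg (Nat.cast_nonneg n : (0 : ℝ) ≤ n)
        (Nat.cast_nonneg k : (0 : ℝ) ≤ k)]]
    have e4 : n + 2 + k + (n + 1) = (n + 2 + k + n) + 1 := by ring
    rw [e1, e2, e3, e4, Nat.factorial_succ (n + 2 + k + n), Nat.factorial_succ k,
      Nat.factorial_succ n]
    push_cast
    have : ((n + 2 + k + n)! : ℝ) ≠ 0 := by positivity
    have : (k : ℝ) + 1 ≠ 0 := by positivity
    have : (2 * n + 3 + k : ℝ) ≠ 0 := by positivity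
    have : (n + 2 + k + n + 1 : ℝ) ≠ 0 := by positivity
    field_simp
    ring

/-- Raising `D` by one multiplies the product by `(D + 1)² / ((D + 1 - m)(D + 1 + m))`. The base
case `D = m` has only factors `j < m`, which the previous lemma evaluates. -/
theorem prod_erase_sq_div_abs_sq_sub_sq {m D : ℕ} (hm : 1 ≤ m) (hD : m ≤ D) :
    ∏ j ∈ (Finset.Icc 1 D).erase m, (j : ℝ) ^ 2 / |(j : ℝ) ^ 2 - (m : ℝ) ^ 2| =
      2 * (D ! : ℝ) ^ 2 / ((D - m)! * (D + m)!) := by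
  induction D, hD using Nat.le_induction with
  | base =>
    obtain ⟨k, rfl⟩ : ∃ k, m = k + 1 := ⟨m - 1, by omega⟩
    have : (Finset.Icc 1 (k + 1)).erase (k + 1) = Finset.Icc 1 k := by
      ext x; grind
    rw [this, prod_sq_div_abs_sq_sub_sq_of_lt (Nat.lt_succ_self k)]
    have e1 : k + 1 - k - 1 = 0 := by omega
    have e2 : k + 1 + (k + 1) = (k + 1 + k) + 1 := by ring
    rw [e1, e2, Nat.factorial_succ (k + 1 + k), Nat.factorial_succ k, Nat.sub_self]
    have : ((k + 1 + k)! : ℝ) ≠ 0 := by positivity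
    have : ((k + 1 + k + 1 : ℕ) : ℝ) ≠ 0 := by positivity
    simp only [Nat.factorial_zero, Nat.cast_one, one_mul, mul_one]
    push_cast at *
    field_simp
    ring
  | succ D hD ih =>
    have : (Finset.Icc 1 (D + 1)).erase m = insert (D + 1) ((Finset.Icc 1 D).erase m) := by
      ext x; simp; omega
    rw [this, Finset.prod_insert (by simp), ih]
    obtain ⟨k, rfl⟩ : ∃ k, D = m + k := ⟨D - m, by omega⟩
    have e1 : m + k - m = k := by omega
    have e2 : m + k + 1 - m = k + 1 := by omega
    have e3 : |((m + k + 1 : ℕ) : ℝ) ^ 2 - (m : ℝ) ^ 2| = (k + 1) * (2 * m + k + 1) := by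
      have : ((m + k + 1 : ℕ) : ℝ) ^ 2 - (m : ℝ) ^ 2 = (k + 1) * (2 * m + k + 1) := by
        push_cast; ring
      rw [this, abs_of_nonneg (by positivity)]
    have e4 : m + k + 1 + m = (m + k + m) + 1 := by ring
    rw [e1, e2, e3, e4, Nat.factorial_succ (m + k + m), Nat.factorial_succ k,
      Nat.factorial_succ (m + k)]
    push_cast
    have : ((m + k + m)! : ℝ) ≠ 0 := by positivity
    have : (k : ℝ) + 1 ≠ 0 := by positivity
    have : (2 * m + k + 1 : ℝ) ≠ 0 := by positivity
    have : (m + k + m + 1 : ℝ) ≠ 0 := by positivity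
    field_simp
    ring

/-- Relative to `D !`, the first factorial loses `m` factors that are at most `D`, and the second
gains `m` factors that are at least `D + 1`. -/
theorem sq_factorial_le_factorial_sub_mul_factorial_add {m D : ℕ} (hD : m ≤ D) :
    D ! ^ 2 ≤ (D - m)! * (D + m)! := by
  calc D ! ^ 2 = ((D - m)! * D.descFactorial m) * D ! := by
        rw [Nat.factorial_mul_descFactorial hD, sq]
    _ ≤ ((D - m)! * (D + 1) ^ m) * D ! := by
        gcongr
        exact (Nat.descFactorial_le_pow D m).trans (Nat.pow_le_pow_left (Nat.le_succ D) m)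
    _ = (D - m)! * (D ! * (D + 1) ^ m) := by ring
    _ ≤ _ := by gcongr; exact Nat.factorial_mul_pow_le_factorial

theorem prod_erase_sq_div_abs_sq_sub_sq_le {m D : ℕ} (hm : 1 ≤ m) (hD : m ≤ D) :
    ∏ j ∈ (Finset.Icc 1 D).erase m, (j : ℝ) ^ 2 / |(j : ℝ) ^ 2 - (m : ℝ) ^ 2| ≤ 2 := by
  rw [prod_erase_sq_div_abs_sq_sub_sq hm hD, div_le_iff₀ (by positivity)]
  gcongr
  exact_mod_cast sq_factorial_le_factorial_sub_mul_factorial_add hD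

end FactorialProducts

/-- If `y j / j ^ 2` is nondecreasing, then the gaps of `y` are large enough for the product
to be bounded. -/
theorem prod_erase_div_abs_sub_le {y : ℕ → ℝ} {m D : ℕ} (hm : m ∈ Finset.Icc 1 D)
    (hy : ∀ i ∈ Finset.Icc 1 D, 0 < y i)
    (hmono : ∀ i ∈ Finset.Icc 1 D, ∀ j ∈ Finset.Icc 1 D, i < j →
      y i * (j : ℝ) ^ 2 ≤ y j * (i : ℝ) ^ 2) :
    ∏ j ∈ (Finset.Icc 1 D).erase m, y j / |y j - y m| ≤ 2 := by
  obtain ⟨h1, h2⟩ := Finset.mem_Icc.1 hm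
  refine le_trans (Finset.prod_le_prod (fun j hj => ?_) fun j hj => ?_)
    (prod_erase_sq_div_abs_sq_sub_sq_le h1 h2)
  · exact div_nonneg (hy j (Finset.mem_of_mem_erase hj)).le (abs_nonneg _)
  · obtain ⟨hne, hj⟩ := Finset.mem_erase.1 hj
    have hj1 : (1 : ℝ) ≤ j := by exact_mod_cast (Finset.mem_Icc.1 hj).1
    have hm1 : (1 : ℝ) ≤ m := by exact_mod_cast h1
    have hyj := hy j hj
    -- Factor by factor, `y j / |y j - y m|` is at most its value for the extremal sequence `y j = j
    -- ^ 2`.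
    have hmul : y j * |(j : ℝ) ^ 2 - (m : ℝ) ^ 2| ≤ (j : ℝ) ^ 2 * |y j - y m| := by
      rcases lt_or_gt_of_ne hne with h | h
      · have := hmono j hj m hm h
        have hlt : (j : ℝ) < m := by exact_mod_cast h
        rw [abs_of_nonpos (by nlinarith)]
        nlinarith [neg_le_abs (y j - y m), sq_nonneg (j : ℝ)]
      · have := hmono m hm j hj h
        have hlt : (m : ℝ) < j := by exact_mod_cast h
        rw [abs_of_nonneg (by nlinarith)]
        nlinarith [le_abs_self (y j - y m), sq_nonneg (j : ℝ)]
    have hpos : 0 < |(j : ℝ) ^ 2 - (m : ℝ) ^ 2| := by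
      rw [abs_pos, sub_ne_zero]
      intro h
      exact hne (by exact_mod_cast (pow_left_inj₀ (by positivity) (by positivity) two_ne_zero).1 h)
    have hpos' : 0 < |y j - y m| := by
      have : 0 < (j : ℝ) ^ 2 * |y j - y m| := lt_of_lt_of_le (by positivity) hmul
      exact pos_of_mul_pos_right this (by positivity)
    rwa [div_le_div_iff₀ hpos' hpos]

theorem sum_Icc_inv_sq_le (n : ℕ) : ∑ i ∈ Finset.Icc 1 n, ((i : ℝ) ^ 2)⁻¹ ≤ 2 := by
  have := sum_Ioo_inv_sq_le (α := ℝ) 0 (n + 1)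
  have h : Finset.Ioo 0 (n + 1) = Finset.Icc 1 n := by ext; simp; omega
  rw [h] at this
  simpa using this

/-! ### The divided-difference inequality for Laurent polynomials -/

theorem Finset.prod_erase_image {ι α M : Type*} [DecidableEq ι] [DecidableEq α] [CommMonoid M]
    {s : Finset ι} {f : ι → α} (hf : Set.InjOn f s) {m : ι} (hm : m ∈ s) (g : α → M) :
    ∏ j ∈ (s.image f).erase (f m), g j = ∏ i ∈ s.erase m, g (f i) := by
  have : (s.image f).erase (f m) = (s.erase m).image f := by
    ext x
    simp only [Finset.mem_erase, Finset.mem_image]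
    constructor
    · rintro ⟨hx, i, hi, rfl⟩
      exact ⟨i, ⟨fun h => hx (by rw [h]), hi⟩, rfl⟩
    · rintro ⟨i, ⟨hne, hi⟩, rfl⟩
      exact ⟨fun h => hne (hf hi hm h), i, hi, rfl⟩
  rw [this, Finset.prod_image (fun a ha b hb => hf (Finset.mem_of_mem_erase ha)
    (Finset.mem_of_mem_erase hb))]

open Polynomial in
/-- A Laurent polynomial `q(k) = P(k) / k ^ E` with values in `[0, 1]` on a set of nodes obeys
the linear relation given by the leading divided difference. -/
theorem sub_le_sum_of_laurent {K : Finset ℕ} {w E : ℕ} {P : ℝ[X]} {q : ℕ → ℝ} (hw : 0 < w)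
    (hwK : w ∉ K) (hwK' : 2 * w ∉ K) (hE : E ≤ K.card) (hP : P.natDegree ≤ K.card)
    (hq : ∀ k ∈ insert w (insert (2 * w) K), (k : ℝ) ^ E * q k = P.eval (k : ℝ))
    (hq0 : ∀ k ∈ insert w (insert (2 * w) K), 0 ≤ q k)
    (hq1 : ∀ k ∈ insert w (insert (2 * w) K), q k ≤ 1) :
    q (2 * w) - q w ≤ ∑ k ∈ K, ((k : ℝ) / w) ^ E * ((w / |(k : ℝ) - 2 * w|) *
      ∏ j ∈ K.erase k, |(w : ℝ) - j| / |(k : ℝ) - j|) := by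
  set s := insert w (insert (2 * w) K) with hs
  have hw' : (0 : ℝ) < w := by exact_mod_cast hw
  have hw1 : w ∉ insert (2 * w) K := by simp [hwK]; omega
  have hcard : s.card = K.card + 2 := by
    rw [hs, Finset.card_insert_of_notMem hw1, Finset.card_insert_of_notMem hwK']
  -- `G(k) = k ^ E (q k - q (2w))` vanishes at `2w`, so that node drops out of the relation, and
  -- elsewhere the bracket is at most 1 in absolute value.
  set G : ℝ[X] := P - C (q (2 * w)) * X ^ E with hG
  have hGdeg : G.natDegree ≤ K.card :=
    (natDegree_sub_le_of_le hP ((natDegree_C_mul_X_pow_le _ _).trans hE)).trans (by simp)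
  have hGeval : ∀ k ∈ s, G.eval (k : ℝ) = (k : ℝ) ^ E * (q k - q (2 * w)) := fun k hk => by
    rw [hG, eval_sub, ← hq k hk]; simp; ring
  -- The coefficient is the one of index `s.card - 1 = K.card + 1`, which exceeds the degree of `G`
  -- and hence is zero.
  have hlag := Lagrange.coeff_eq_sum (s := s) (v := fun n : ℕ => (n : ℝ)) (P := G)
    Nat.cast_injective.injOn
    (lt_of_le_of_lt (natDegree_le_iff_degree_le.1 hGdeg) (by rw [hcard]; exact_mod_cast (by omega)))
  rw [coeff_eq_zero_of_natDegree_lt (by omega), hs, Finset.sum_insert hw1,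
    Finset.sum_insert hwK', ← hs, hGeval (2 * w) (by simp [hs]), sub_self, mul_zero, zero_div,
    zero_add] at hlag
  have hprodw : ∏ j ∈ s.erase w, ((w : ℝ) - j) = -w * ∏ j ∈ K, ((w : ℝ) - j) := by
    rw [hs, Finset.erase_insert hw1, Finset.prod_insert hwK']
    push_cast; ring
  have hprodk : ∀ k ∈ K, ∏ j ∈ s.erase k, ((k : ℝ) - j) =
      (k - w) * ((k - 2 * w) * ∏ j ∈ K.erase k, ((k : ℝ) - j)) := fun k hk => by
    have h1 : k ≠ w := fun h => hwK (h ▸ hk)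
    have h2 : k ≠ 2 * w := fun h => hwK' (h ▸ hk)
    rw [hs, Finset.erase_insert_of_ne h1.symm, Finset.erase_insert_of_ne h2.symm,
      Finset.prod_insert (by simp [hwK]; omega), Finset.prod_insert (by simp [hwK'])]
    push_cast; ring
  have hA : ∏ j ∈ K, ((w : ℝ) - j) ≠ 0 := by
    rw [Finset.prod_ne_zero_iff]
    intro j hj h
    rw [sub_eq_zero, Nat.cast_inj] at h
    exact hwK (h ▸ hj)
  set A := ∏ j ∈ K, ((w : ℝ) - j) with hAdef
  have key : (w : ℝ) ^ E * (q (2 * w) - q w) =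
      ∑ k ∈ K, w * A * (G.eval (k : ℝ) /
        ((k - w) * ((k - 2 * w) * ∏ j ∈ K.erase k, ((k : ℝ) - j)))) * (-1) := by
    rw [hprodw, hGeval w (by simp [hs]), Finset.sum_congr rfl fun k hk => by rw [hprodk k hk]] at hlag
    rw [← Finset.sum_mul, ← Finset.mul_sum]
    have : ∑ k ∈ K, (G.eval (k : ℝ) /
        ((k - w) * ((k - 2 * w) * ∏ j ∈ K.erase k, ((k : ℝ) - j)))) =
        - ((w : ℝ) ^ E * (q w - q (2 * w)) / (-w * A)) := by linarith
    rw [this]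
    field_simp
    ring
  have hwE : (0 : ℝ) < (w : ℝ) ^ E := by positivity
  refine le_of_mul_le_mul_left ?_ hwE
  rw [key, Finset.mul_sum]
  refine Finset.sum_le_sum fun k hk => (le_abs_self _).trans ?_
  have hkw : (k : ℝ) - w ≠ 0 := by
    rw [sub_ne_zero]; intro h; exact hwK (Nat.cast_injective h ▸ hk)
  have hks : k ∈ s := by simp [hs, hk]
  have h01 : |q k - q (2 * w)| ≤ 1 := by
    have := hq0 k hks; have := hq1 k hks
    have := hq0 (2 * w) (by simp [hs]); have := hq1 (2 * w) (by simp [hs])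
    rw [abs_le]; constructor <;> linarith
  -- The factor `|k - w|` cancels the one in the weight of `k`, so only `w / |k - 2w|` survives
  -- outside the product.
  have hAk : |A| = |(k : ℝ) - w| * ∏ j ∈ K.erase k, |(w : ℝ) - j| := by
    rw [hAdef, Finset.abs_prod, ← Finset.mul_prod_erase _ _ hk, abs_sub_comm]
  rw [hGeval k hks, Finset.prod_div_distrib]
  simp only [abs_mul, abs_div, abs_neg, abs_one, mul_one, Finset.abs_prod, hAk,
    Nat.abs_cast, abs_pow]
  have hkw' : 0 < |(k : ℝ) - w| := abs_pos.2 hkw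
  calc _ = ((k : ℝ) ^ E * (w / |(k : ℝ) - 2 * w| * ((∏ j ∈ K.erase k, |(w : ℝ) - j|) /
        ∏ j ∈ K.erase k, |(k : ℝ) - j|))) * |q k - q (2 * w)| := by
        field_simp
    _ ≤ ((k : ℝ) ^ E * (w / |(k : ℝ) - 2 * w| * ((∏ j ∈ K.erase k, |(w : ℝ) - j|) /
        ∏ j ∈ K.erase k, |(k : ℝ) - j|))) * 1 := by
        gcongr
    _ = _ := by rw [div_pow]; field_simp

/-! ### Weights of the low and high nodes -/

section Nodes

variable {C w D E : ℕ} {l : ℕ → ℕ}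

/-- Contribution of the node `l m < w`. -/
theorem low_node_term_le (hC : 4 ≤ C)
    (hl0 : ∀ i ∈ Finset.Icc 1 E, 0 < l i) (hlw : ∀ i ∈ Finset.Icc 1 E, l i < w)
    (hmono : ∀ i ∈ Finset.Icc 1 E, ∀ j ∈ Finset.Icc 1 E, i < j → j ^ 2 * l j ≤ i ^ 2 * l i)
    {m : ℕ} (hm : m ∈ Finset.Icc 1 E) :
    ((l m : ℝ) / w) ^ E * ((w / |(l m : ℝ) - 2 * w|) *
      ((∏ i ∈ (Finset.Icc 1 E).erase m, |(w : ℝ) - l i| / |(l m : ℝ) - l i|) *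
        ∏ i ∈ Finset.Icc 1 D, |(w : ℝ) - (C * i ^ 2 * w : ℕ)| / |(l m : ℝ) - (C * i ^ 2 * w : ℕ)|))
      ≤ 2 * (l m / w) := by
  have hlm0 : (0 : ℝ) < l m := by exact_mod_cast hl0 m hm
  have hlmw : (l m : ℝ) < w := by exact_mod_cast hlw m hm
  have hw : (0 : ℝ) < w := hlm0.trans hlmw
  -- A high node is at least as far from `l m` as from `w`, since `l m < w`.
  have hhigh : ∏ i ∈ Finset.Icc 1 D,
      |(w : ℝ) - (C * i ^ 2 * w : ℕ)| / |(l m : ℝ) - (C * i ^ 2 * w : ℕ)| ≤ 1 := by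
    refine Finset.prod_le_one (fun i _ => by positivity) fun i hi => ?_
    have hle : (w : ℝ) ≤ (C * i ^ 2 * w : ℕ) := by
      have : 0 < C * i ^ 2 := by have := (Finset.mem_Icc.1 hi).1; positivity
      exact_mod_cast Nat.le_mul_of_pos_left w this
    rw [abs_of_nonpos (by linarith), abs_of_nonpos (by linarith)]
    exact div_le_one_of_le₀ (by linarith) (by linarith)
  -- One factor `l m / w` goes to each of the `E - 1` other low nodes. This turns the gap ratios
  -- into those of `y i = 1 / l i`, where `hmono` gives quadratic spacing. The last factor `l m / w`
  -- is kept for the final bound.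
  have hlow : ((l m : ℝ) / w) ^ (E - 1) *
      ∏ i ∈ (Finset.Icc 1 E).erase m, |(w : ℝ) - l i| / |(l m : ℝ) - l i| ≤ 2 := by
    have hcard : ((Finset.Icc 1 E).erase m).card = E - 1 := by
      rw [Finset.card_erase_of_mem hm, Nat.card_Icc]; omega
    rw [← hcard, ← Finset.prod_const, ← Finset.prod_mul_distrib]
    refine le_trans (Finset.prod_le_prod (fun i _ => by positivity) fun i hi => ?_)
      (prod_erase_div_abs_sub_le (y := fun i => ((l i : ℝ))⁻¹) hm
        (fun i hi => inv_pos.2 (by exact_mod_cast hl0 i hi)) fun i hi j hj hij => ?_)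
    · have hi' := Finset.mem_of_mem_erase hi
      have hli0 : (0 : ℝ) < l i := by exact_mod_cast hl0 i hi'
      have hliw : (l i : ℝ) < w := by exact_mod_cast hlw i hi'
      have e : ((l i : ℝ))⁻¹ - ((l m : ℝ))⁻¹ = (l m - l i) / (l i * l m) := by
        field_simp
      rw [e, abs_div, abs_of_pos (by positivity : (0 : ℝ) < l i * l m),
        abs_of_pos (sub_pos.2 hliw)]
      calc (l m : ℝ) / w * ((w - l i) / |(l m : ℝ) - l i|)
          = ((w - l i) / w) * (l m / |(l m : ℝ) - l i|) := by ring
        _ ≤ 1 * (l m / |(l m : ℝ) - l i|) := by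
          gcongr
          exact div_le_one_of_le₀ (by linarith) hw.le
        _ = _ := by field_simp
    · have hli0 : (0 : ℝ) < l i := by exact_mod_cast hl0 i hi
      have hlj0 : (0 : ℝ) < l j := by exact_mod_cast hl0 j hj
      have : (j : ℝ) ^ 2 * l j ≤ (i : ℝ) ^ 2 * l i := by exact_mod_cast hmono i hi j hj hij
      rw [inv_mul_eq_div, inv_mul_eq_div, div_le_div_iff₀ hli0 hlj0]
      exact this
  have hfac : (l m : ℝ) / w * (w / |(l m : ℝ) - 2 * w|) ≤ l m / w := by
    rw [abs_of_nonpos (by linarith), div_mul_div_cancel₀ hw.ne']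
    gcongr
    linarith
  obtain ⟨F, rfl⟩ : ∃ F, E = F + 1 := ⟨E - 1, by have := Finset.mem_Icc.1 hm; omega⟩
  rw [Nat.add_sub_cancel] at hlow
  rw [pow_succ]
  set A := ∏ i ∈ (Finset.Icc 1 (F + 1)).erase m, |(w : ℝ) - l i| / |(l m : ℝ) - l i|
  set B := ∏ i ∈ Finset.Icc 1 D,
      |(w : ℝ) - (C * i ^ 2 * w : ℕ)| / |(l m : ℝ) - (C * i ^ 2 * w : ℕ)|
  have hA : 0 ≤ A := Finset.prod_nonneg fun i _ => by positivity
  have hB : 0 ≤ B := Finset.prod_nonneg fun i _ => by positivity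
  calc _ = (((l m : ℝ) / w) ^ F * A) * ((l m : ℝ) / w * (w / |(l m : ℝ) - 2 * w|)) * B := by ring
    _ ≤ 2 * (l m / w) * 1 := by gcongr
    _ = _ := by ring

/-- Contribution of the node `C * m ^ 2 * w > 2 * w`. -/
theorem high_node_term_le (hC : 4 ≤ C) (hw : 0 < w)
    (hlw : ∀ i ∈ Finset.Icc 1 E, l i < w) {m : ℕ} (hm : m ∈ Finset.Icc 1 D) :
    (((C * m ^ 2 * w : ℕ) : ℝ) / w) ^ E * ((w / |((C * m ^ 2 * w : ℕ) : ℝ) - 2 * w|) *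
      ((∏ i ∈ Finset.Icc 1 E, |(w : ℝ) - l i| / |((C * m ^ 2 * w : ℕ) : ℝ) - l i|) *
        ∏ i ∈ (Finset.Icc 1 D).erase m,
          |(w : ℝ) - (C * i ^ 2 * w : ℕ)| / |((C * m ^ 2 * w : ℕ) : ℝ) - (C * i ^ 2 * w : ℕ)|))
      ≤ 4 / C * ((m : ℝ) ^ 2)⁻¹ := by
  have hw' : (0 : ℝ) < w := by exact_mod_cast hw
  have hC' : (4 : ℝ) ≤ C := by exact_mod_cast hC
  have hm1 : (1 : ℝ) ≤ (m : ℝ) ^ 2 := by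
    have : (1 : ℝ) ≤ m := by exact_mod_cast (Finset.mem_Icc.1 hm).1
    nlinarith
  have hCm : (4 : ℝ) ≤ C * (m : ℝ) ^ 2 := by nlinarith
  have hhigh : ∏ i ∈ (Finset.Icc 1 D).erase m,
      |(w : ℝ) - (C * i ^ 2 * w : ℕ)| / |((C * m ^ 2 * w : ℕ) : ℝ) - (C * i ^ 2 * w : ℕ)| ≤ 2 := by
    refine le_trans (Finset.prod_le_prod (fun i _ => by positivity) fun i hi => ?_)
      (prod_erase_div_abs_sub_le (y := fun i => ((C * i ^ 2 * w : ℕ) : ℝ)) hm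
        (fun i hi => ?_) fun i hi j hj hij => ?_)
    · have hle : (w : ℝ) ≤ (C * i ^ 2 * w : ℕ) := by
        have : 0 < C * i ^ 2 := by
          have := (Finset.mem_Icc.1 (Finset.mem_of_mem_erase hi)).1; positivity
        exact_mod_cast Nat.le_mul_of_pos_left w this
      rw [abs_of_nonpos (by linarith : (w : ℝ) - (C * i ^ 2 * w : ℕ) ≤ 0),
        abs_sub_comm ((C * m ^ 2 * w : ℕ) : ℝ)]
      gcongr
      linarith
    · have := (Finset.mem_Icc.1 hi).1
      have : 0 < C * i ^ 2 * w := by positivity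
      exact_mod_cast this
    · push_cast
      apply le_of_eq; ring
  -- Each low node absorbs one factor `C m²`, because `C m² (w - l i) ≤ C m² w - l i`.
  have hlow : ((C * (m : ℝ) ^ 2)) ^ E *
      ∏ i ∈ Finset.Icc 1 E, |(w : ℝ) - l i| / |C * (m : ℝ) ^ 2 * w - l i| ≤ 1 := by
    have hcard : (Finset.Icc 1 E).card = E := by simp
    nth_rewrite 1 [← hcard]
    rw [← Finset.prod_const, ← Finset.prod_mul_distrib]
    refine Finset.prod_le_one (fun i _ => by positivity) fun i hi => ?_
    have hliw : (l i : ℝ) < w := by exact_mod_cast hlw i hi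
    have hli0 : (0 : ℝ) ≤ l i := by positivity
    have h1 : (w : ℝ) ≤ C * (m : ℝ) ^ 2 * w := by nlinarith
    rw [abs_of_pos (by linarith), abs_of_pos (by linarith), ← mul_div_assoc]
    refine div_le_one_of_le₀ ?_ (by linarith)
    nlinarith
  have hfac : (w : ℝ) / |C * (m : ℝ) ^ 2 * w - 2 * w| ≤ 2 / C * ((m : ℝ) ^ 2)⁻¹ := by
    have e : C * (m : ℝ) ^ 2 * w - 2 * w = (C * (m : ℝ) ^ 2 - 2) * w := by ring
    rw [e, abs_of_pos (mul_pos (by linarith) hw'), ← div_div, div_right_comm, div_self hw'.ne',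
      ← div_eq_mul_inv, div_div]
    rw [div_le_div_iff₀ (by linarith) (by linarith)]
    linarith
  have e : ((C * m ^ 2 * w : ℕ) : ℝ) / w = C * (m : ℝ) ^ 2 := by
    push_cast; field_simp
  rw [e]
  set B := ∏ i ∈ (Finset.Icc 1 D).erase m,
      |(w : ℝ) - (C * i ^ 2 * w : ℕ)| / |((C * m ^ 2 * w : ℕ) : ℝ) - (C * i ^ 2 * w : ℕ)|
  have hB : 0 ≤ B := Finset.prod_nonneg fun i _ => by positivity
  rw [show ((C * m ^ 2 * w : ℕ) : ℝ) = C * (m : ℝ) ^ 2 * w by push_cast; rfl]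
  set A := ∏ i ∈ Finset.Icc 1 E, |(w : ℝ) - l i| / |C * (m : ℝ) ^ 2 * w - l i|
  have hA : 0 ≤ A := Finset.prod_nonneg fun i _ => by positivity
  calc _ = ((C * (m : ℝ) ^ 2) ^ E * A) * (w / |C * (m : ℝ) ^ 2 * w - 2 * w|) * B := by ring
    _ ≤ 1 * (2 / C * ((m : ℝ) ^ 2)⁻¹) * 2 := by gcongr
    _ = _ := by ring

end Nodes

/-! ### Choice of the nodes and the gap bound -/

/-- Without rounding, `i² · (2E³ / i²)` would be constant. Rounding down loses less than `i²`, and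
the subtracted `i` compensates for this since `i³ + i² ≤ j³`. -/
theorem sq_mul_div_sq_sub_mono {E i j : ℕ} (hi : 1 ≤ i) (hij : i < j) :
    j ^ 2 * (2 * E ^ 3 / j ^ 2 - j) ≤ i ^ 2 * (2 * E ^ 3 / i ^ 2 - i) := by
  have h1 : j ^ 2 * (2 * E ^ 3 / j ^ 2) ≤ 2 * E ^ 3 := Nat.mul_div_le _ _
  have h2 : 2 * E ^ 3 < i ^ 2 * (2 * E ^ 3 / i ^ 2) + i ^ 2 := by
    have := Nat.lt_mul_div_succ (2 * E ^ 3) (show 0 < i ^ 2 by positivity)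
    linarith
  have h3 : i ^ 3 + i ^ 2 ≤ j ^ 3 := by
    calc i ^ 3 + i ^ 2 ≤ (i + 1) ^ 3 := by ring_nf; omega
      _ ≤ j ^ 3 := Nat.pow_le_pow_left hij 3
  rw [Nat.mul_sub, Nat.mul_sub]
  have e1 : j ^ 2 * j = j ^ 3 := by ring
  have e2 : i ^ 2 * i = i ^ 3 := by ring
  rw [e1, e2]
  omega

/-- The factor 2 leaves room for the correction `- i`: the quotient is at least `2E`, while `i ≤ E`.
-/
theorem pos_div_sq_sub {E i : ℕ} (hi : 1 ≤ i) (hE : i ≤ E) : 0 < 2 * E ^ 3 / i ^ 2 - i := by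
  have : 2 * E ≤ 2 * E ^ 3 / i ^ 2 := by
    rw [Nat.le_div_iff_mul_le (by positivity)]
    calc 2 * E * i ^ 2 ≤ 2 * E * E ^ 2 := by gcongr
      _ = _ := by ring
  omega

open Polynomial in
/-- A Laurent polynomial with values in `[0, 1]` on `{1, …, N}`, of low degree both in `k` and in
`1 / k`, takes nearby values at `w` and `2 * w`. -/
theorem laurent_sub_le {C N w D E : ℕ} {P : ℝ[X]} {q : ℕ → ℝ} (hC : 4 ≤ C) (hw : 0 < w)
    (hN : 2 * w ≤ N) (hD : C * D ^ 2 * w ≤ N) (hE : 2 * E ^ 3 < w) (hP : P.natDegree ≤ E + D)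
    (hq : ∀ k, 1 ≤ k → k ≤ N → (k : ℝ) ^ E * q k = P.eval (k : ℝ))
    (hq0 : ∀ k, 1 ≤ k → k ≤ N → 0 ≤ q k) (hq1 : ∀ k, 1 ≤ k → k ≤ N → q k ≤ 1) :
    q (2 * w) - q w ≤ 8 * (E : ℝ) ^ 3 / w + 8 / C := by
  have hw' : (0 : ℝ) < w := by exact_mod_cast hw
  -- The low nodes satisfy `1 / l i ≈ i² / (2E³)`, and the largest is below `w` by `hE`. With `w`
  -- and `2w` there are `E + D + 2` nodes, just enough for degree `E + D`.
  set l : ℕ → ℕ := fun i => 2 * E ^ 3 / i ^ 2 - i with hl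
  set h : ℕ → ℕ := fun i => C * i ^ 2 * w with hh
  have hl0 : ∀ i ∈ Finset.Icc 1 E, 0 < l i := fun i hi =>
    pos_div_sq_sub (Finset.mem_Icc.1 hi).1 (Finset.mem_Icc.1 hi).2
  have hlw : ∀ i ∈ Finset.Icc 1 E, l i < w := fun i _ =>
    lt_of_le_of_lt ((Nat.sub_le _ _).trans (Nat.div_le_self _ _)) hE
  have hmono : ∀ i ∈ Finset.Icc 1 E, ∀ j ∈ Finset.Icc 1 E, i < j →
      j ^ 2 * l j ≤ i ^ 2 * l i := fun i hi j _ hij =>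
    sq_mul_div_sq_sub_mono (Finset.mem_Icc.1 hi).1 hij
  have hlanti : ∀ i ∈ Finset.Icc 1 E, ∀ j ∈ Finset.Icc 1 E, i < j → l j < l i := by
    intro i hi j hj hij
    by_contra hcon
    have h1 := hmono i hi j hj hij
    have h2 : i ^ 2 * l i ≤ i ^ 2 * l j := Nat.mul_le_mul_left _ (not_lt.1 hcon)
    have h3 : i ^ 2 * l j < j ^ 2 * l j :=
      Nat.mul_lt_mul_of_pos_right (Nat.pow_lt_pow_left hij two_ne_zero) (hl0 j hj)
    omega
  have hlinj : Set.InjOn l (Finset.Icc 1 E : Finset ℕ) := by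
    intro i hi j hj hij
    rcases lt_trichotomy i j with hlt | heq | hgt
    · exact absurd hij (hlanti i hi j hj hlt).ne'
    · exact heq
    · exact absurd hij (hlanti j hj i hi hgt).ne
  have hhinj : Set.InjOn h (Finset.Icc 1 D : Finset ℕ) := by
    intro i _ j _ hij
    have h1 : C * i ^ 2 = C * j ^ 2 := Nat.eq_of_mul_eq_mul_right hw hij
    exact Nat.pow_left_injective two_ne_zero (Nat.eq_of_mul_eq_mul_left (by omega) h1)
  have hhw : ∀ i ∈ Finset.Icc 1 D, 4 * w ≤ h i := fun i hi => by
    have := (Finset.mem_Icc.1 hi).1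
    have : 4 ≤ C * i ^ 2 := by nlinarith
    exact Nat.mul_le_mul_right w this
  have hhN : ∀ i ∈ Finset.Icc 1 D, h i ≤ N := fun i hi => by
    refine le_trans ?_ hD
    have := (Finset.mem_Icc.1 hi).2
    simp only [hh]
    gcongr
  set L := (Finset.Icc 1 E).image l with hL
  set H := (Finset.Icc 1 D).image h with hH
  have hLw : ∀ k ∈ L, 0 < k ∧ k < w := fun k hk => by
    obtain ⟨i, hi, rfl⟩ := Finset.mem_image.1 hk
    exact ⟨hl0 i hi, hlw i hi⟩
  have hHw : ∀ k ∈ H, 4 * w ≤ k ∧ k ≤ N := fun k hk => by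
    obtain ⟨i, hi, rfl⟩ := Finset.mem_image.1 hk
    exact ⟨hhw i hi, hhN i hi⟩
  have hdisj : Disjoint L H := Finset.disjoint_left.2 fun k h1 h2 => by
    have := hLw k h1; have := hHw k h2; omega
  have hcard : (L ∪ H).card = E + D := by
    rw [Finset.card_union_of_disjoint hdisj, hL, hH, Finset.card_image_of_injOn hlinj,
      Finset.card_image_of_injOn hhinj]
    simp
  have hrange : ∀ k ∈ insert w (insert (2 * w) (L ∪ H)), 1 ≤ k ∧ k ≤ N := fun k hk => by
    simp only [Finset.mem_insert, Finset.mem_union] at hk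
    rcases hk with rfl | rfl | hk | hk
    · omega
    · omega
    · have := hLw k hk; omega
    · have := hHw k hk; omega
  have hwK : w ∉ L ∪ H := fun hk => by
    rcases Finset.mem_union.1 hk with hk | hk
    · have := hLw _ hk; omega
    · have := hHw _ hk; omega
  have hwK' : 2 * w ∉ L ∪ H := fun hk => by
    rcases Finset.mem_union.1 hk with hk | hk
    · have := hLw _ hk; omega
    · have := hHw _ hk; omega
  refine (sub_le_sum_of_laurent (K := L ∪ H) hw hwK hwK' (by omega) (by omega)
    (fun k hk => hq k (hrange k hk).1 (hrange k hk).2)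
    (fun k hk => hq0 k (hrange k hk).1 (hrange k hk).2)
    (fun k hk => hq1 k (hrange k hk).1 (hrange k hk).2)).trans ?_
  rw [Finset.sum_union hdisj]
  refine add_le_add ?_ ?_
  · rw [hL, Finset.sum_image hlinj, ← hL]
    calc _ ≤ ∑ m ∈ Finset.Icc 1 E, 4 * (E : ℝ) ^ 3 / w * ((m : ℝ) ^ 2)⁻¹ := by
          refine Finset.sum_le_sum fun m hm => ?_
          have hmem : l m ∈ L := Finset.mem_image_of_mem l hm
          have herase : (L ∪ H).erase (l m) = L.erase (l m) ∪ H := by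
            rw [Finset.erase_union_distrib,
              Finset.erase_eq_of_notMem (Finset.disjoint_left.1 hdisj hmem)]
          rw [herase, Finset.prod_union (hdisj.mono_left (Finset.erase_subset _ _)), hL, hH,
            Finset.prod_erase_image hlinj hm, Finset.prod_image hhinj]
          refine (low_node_term_le hC hl0 hlw hmono hm).trans ?_
          have hm1 := (Finset.mem_Icc.1 hm).1
          have hlm : (l m : ℝ) ≤ 2 * (E : ℝ) ^ 3 / (m : ℝ) ^ 2 := by
            calc (l m : ℝ) ≤ ((2 * E ^ 3 / m ^ 2 : ℕ) : ℝ) := by exact_mod_cast Nat.sub_le _ _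
              _ ≤ ((2 * E ^ 3 : ℕ) : ℝ) / ((m ^ 2 : ℕ) : ℝ) := Nat.cast_div_le
              _ = _ := by push_cast; rfl
          calc 2 * ((l m : ℝ) / w) ≤ 2 * ((2 * (E : ℝ) ^ 3 / (m : ℝ) ^ 2) / w) := by gcongr
            _ = _ := by ring
      _ ≤ 4 * (E : ℝ) ^ 3 / w * 2 := by
          rw [← Finset.mul_sum]
          gcongr
          exact sum_Icc_inv_sq_le E
      _ = _ := by ring
  · rw [hH, Finset.sum_image hhinj, ← hH]
    calc _ ≤ ∑ m ∈ Finset.Icc 1 D, 4 / (C : ℝ) * ((m : ℝ) ^ 2)⁻¹ := by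
          refine Finset.sum_le_sum fun m hm => ?_
          have hmem : h m ∈ H := Finset.mem_image_of_mem h hm
          have herase : (L ∪ H).erase (h m) = L ∪ H.erase (h m) := by
            rw [Finset.erase_union_distrib,
              Finset.erase_eq_of_notMem (Finset.disjoint_right.1 hdisj hmem)]
          rw [herase, Finset.prod_union (hdisj.mono_right (Finset.erase_subset _ _)), hL, hH,
            Finset.prod_erase_image hhinj hm, Finset.prod_image hlinj]
          exact high_node_term_le hC hw hlw hm
      _ ≤ 4 / (C : ℝ) * 2 := by
          rw [← Finset.mul_sum]
          gcongr
          exact sum_Icc_inv_sq_le D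
      _ = _ := by ring

/-! ### Polynomials in membership indicators and their symmetrization -/

/-- The functions of a subset `S` of `Fin N` that are polynomials of degree at most `d` in the
indicators of membership in `S`. -/
def subsetPoly (N d : ℕ) : Submodule ℂ (Finset (Fin N) → ℂ) :=
  Submodule.span ℂ {f | ∃ A : Finset (Fin N), A.card ≤ d ∧ f = fun S => if A ⊆ S then 1 else 0}

namespace subsetPoly

variable {N d e : ℕ}

theorem monomial_mem {A : Finset (Fin N)} (hA : A.card ≤ d) :
    (fun S => if A ⊆ S then 1 else 0) ∈ subsetPoly N d :=
  Submodule.subset_span ⟨A, hA, rfl⟩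

theorem mono (h : d ≤ e) : subsetPoly N d ≤ subsetPoly N e :=
  Submodule.span_mono fun _ ⟨A, hA, hf⟩ => ⟨A, hA.trans h, hf⟩

theorem const_mem (c : ℂ) : (fun _ => c) ∈ subsetPoly N d := by
  have := (subsetPoly N d).smul_mem c (monomial_mem (A := ∅) (by simp))
  convert this using 1
  ext S; simp

/-- The monomials of `A` and `B` multiply to that of `A ∪ B`, because indicators are idempotent. -/
theorem mul_mem {f g : Finset (Fin N) → ℂ} (hf : f ∈ subsetPoly N d) (hg : g ∈ subsetPoly N e) :
    (fun S => f S * g S) ∈ subsetPoly N (d + e) := by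
  have h : subsetPoly N d * subsetPoly N e ≤ subsetPoly N (d + e) := by
    unfold subsetPoly
    rw [Submodule.span_mul_span]
    refine Submodule.span_mono ?_
    rintro _ ⟨_, ⟨A, hA, rfl⟩, _, ⟨B, hB, rfl⟩, rfl⟩
    refine ⟨A ∪ B, (Finset.card_union_le A B).trans (by omega), ?_⟩
    ext S
    simp only [Pi.mul_apply, Finset.union_subset_iff]
    split_ifs <;> simp_all
  exact h (Submodule.mul_mem_mul hf hg)

theorem indicator_mem (i : Fin N) : (fun S => if i ∈ S then 1 else 0) ∈ subsetPoly N 1 := by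
  simpa using monomial_mem (d := 1) (A := {i}) (by simp)

theorem card_mem : (fun S => (S.card : ℂ)) ∈ subsetPoly N 1 := by
  have h : (∑ i : Fin N, fun S : Finset (Fin N) => if i ∈ S then (1 : ℂ) else 0) ∈
      subsetPoly N 1 := Submodule.sum_mem _ fun i _ => indicator_mem i
  convert h using 1
  ext S
  simp [Finset.sum_apply]

theorem card_pow_mem (n : ℕ) : (fun S => (S.card : ℂ) ^ n) ∈ subsetPoly N n := by
  induction n with
  | zero => simpa using const_mem (N := N) (d := 0) 1
  | succ n ih => simpa [pow_succ] using mul_mem ih card_mem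

theorem prod_indicator_mem {r : ℕ} (v : Fin r → Fin N) :
    (fun S => ∏ k, if v k ∈ S then (1 : ℂ) else 0) ∈ subsetPoly N r := by
  induction r with
  | zero => simpa using const_mem (N := N) (d := 0) 1
  | succ r ih =>
    simp only [Fin.prod_univ_castSucc]
    exact mul_mem (ih _) (indicator_mem _)

theorem star_mem {f : Finset (Fin N) → ℂ} (hf : f ∈ subsetPoly N d) :
    (fun S => star (f S)) ∈ subsetPoly N d := by
  induction hf using Submodule.span_induction with
  | mem f hf =>
    obtain ⟨A, hA, rfl⟩ := hf
    have : (fun S => star (if A ⊆ S then (1 : ℂ) else 0)) = fun S => if A ⊆ S then 1 else 0 := by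
      ext S
      rw [apply_ite star, star_one, star_zero]
    rw [this]
    exact monomial_mem hA
  | zero => simpa using const_mem (N := N) (d := d) 0
  | add f g _ _ hf hg =>
    convert (subsetPoly N d).add_mem hf hg using 1
    ext S; simp
  | smul c f _ hf =>
    have := (subsetPoly N d).smul_mem (star c) hf
    convert this using 1
    ext S; simp

open Polynomial

/-- Symmetrization: averaging over the subsets of size `k` gives a polynomial in `k`. -/
theorem exists_polynomial_average {f : Finset (Fin N) → ℂ} (hf : f ∈ subsetPoly N d) :
    ∃ P : ℂ[X], P.natDegree ≤ d ∧ ∀ k ≤ N,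
      ∑ S ∈ Finset.powersetCard k Finset.univ, f S = N.choose k * P.eval (k : ℂ) := by
  induction hf using Submodule.span_induction with
  | mem f hf =>
    obtain ⟨A, hA, rfl⟩ := hf
    have hAN : A.card ≤ N := by simpa using Finset.card_le_univ A
    have hdf : (N.descFactorial A.card : ℂ) ≠ 0 := by
      exact_mod_cast (Nat.descFactorial_pos.2 hAN).ne'
    -- With `a = A.card`, a random `k`-subset contains `A` with probability `k(k-1)⋯(k-a+1) /
    -- (N(N-1)⋯(N-a+1))`, a polynomial in `k` of degree `a`.
    refine ⟨C ((N.descFactorial A.card : ℂ)⁻¹) * descPochhammer ℂ A.card,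
      (natDegree_C_mul_le _ _).trans (by rwa [descPochhammer_natDegree]), fun k hk => ?_⟩
    rw [eval_mul, eval_C, descPochhammer_eval_eq_descFactorial, Finset.sum_boole]
    rcases lt_or_ge k A.card with hlt | hge
    · rw [Nat.descFactorial_of_lt hlt, Finset.filter_false_of_mem]
      · simp
      · intro S hS hAS
        have := Finset.card_le_card hAS
        rw [(Finset.mem_powersetCard.1 hS).2] at this
        omega
    · rw [Finset.card_filter_powersetCard_subset _ _ _ (Finset.subset_univ _) hge]
      have h := Nat.choose_mul (n := N) hge
      have h' : N.choose k * k.descFactorial A.card =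
          N.descFactorial A.card * (N - A.card).choose (k - A.card) := by
        rw [Nat.descFactorial_eq_factorial_mul_choose, Nat.descFactorial_eq_factorial_mul_choose]
        linear_combination A.card.factorial * h
      have h'' : (N.choose k : ℂ) * k.descFactorial A.card =
          N.descFactorial A.card * (N - A.card).choose (k - A.card) := by exact_mod_cast h'
      rw [Finset.card_univ, Fintype.card_fin]
      field_simp
      linear_combination -h''
  | zero => exact ⟨0, by simp, by simp⟩
  | add f g _ _ hf hg =>
    obtain ⟨P, hP, hfP⟩ := hf
    obtain ⟨Q, hQ, hgQ⟩ := hg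
    refine ⟨P + Q, natDegree_add_le_of_degree_le hP hQ, fun k hk => ?_⟩
    simp only [Pi.add_apply, Finset.sum_add_distrib, hfP k hk, hgQ k hk, eval_add]
    ring
  | smul c f _ hf =>
    obtain ⟨P, hP, hfP⟩ := hf
    refine ⟨C c * P, (natDegree_C_mul_le _ _).trans hP, fun k hk => ?_⟩
    simp only [Pi.smul_apply, smul_eq_mul, ← Finset.mul_sum, hfP k hk, eval_mul, eval_C]
    ring

theorem exists_real_polynomial_average {f : Finset (Fin N) → ℝ}
    (hf : (fun S => (f S : ℂ)) ∈ subsetPoly N d) :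
    ∃ P : ℝ[X], P.natDegree ≤ d ∧ ∀ k ≤ N,
      ∑ S ∈ Finset.powersetCard k Finset.univ, f S = N.choose k * P.eval (k : ℝ) := by
  obtain ⟨P, hP, hfP⟩ := exists_polynomial_average hf
  refine ⟨∑ i ∈ Finset.range (d + 1), C (P.coeff i).re * X ^ i, ?_, fun k hk => ?_⟩
  · refine natDegree_sum_le_of_forall_le _ _ fun i hi => ?_
    exact (natDegree_C_mul_X_pow_le _ _).trans (by simpa [Nat.lt_succ_iff] using hi)
  · have h := congrArg Complex.re (hfP k hk)
    rw [← Complex.ofReal_sum, Complex.ofReal_re, ← Complex.ofReal_natCast (N.choose k),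
      Complex.re_ofReal_mul, eval_eq_sum_range' (Nat.lt_succ_of_le hP), Complex.re_sum] at h
    rw [h, eval_finsetSum]
    congr 1
    refine Finset.sum_congr rfl fun i _ => ?_
    rw [eval_mul, eval_C, eval_pow, eval_X, ← Complex.ofReal_natCast k, ← Complex.ofReal_pow,
      Complex.re_mul_ofReal]

end subsetPoly

/-! ### Degrees and unitarity of the gates -/

section Gates

variable {N r m : ℕ}

/-- The factor `|S|` clears the denominator of `|S⟩⟨S|`. For empty `S` both sides are zero. -/
theorem card_mul_reflectionS_apply (S : Finset (Fin N)) (i j : Fin N) :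
    (S.card : ℂ) * reflectionS S i j = (1 : Matrix (Fin N) (Fin N) ℂ) i j * (S.card : ℂ) +
      -2 * ((if i ∈ S then (1 : ℂ) else 0) * (if j ∈ S then (1 : ℂ) else 0)) := by
  have hs : ∀ i ∈ S, (S.card : ℂ) * (((1 / √(S.card : ℝ) : ℝ) : ℂ) *
      ((1 / √(S.card : ℝ) : ℝ) : ℂ)) = 1 := fun i hi => by
    have : (0 : ℝ) < S.card := by exact_mod_cast Finset.card_pos.2 ⟨i, hi⟩
    rw [← Complex.ofReal_mul, ← Complex.ofReal_natCast, ← Complex.ofReal_mul,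
      div_mul_div_comm, Real.mul_self_sqrt this.le, one_mul, mul_one_div_cancel this.ne']
    simp
  simp only [reflectionS, Matrix.sub_apply, Matrix.smul_apply, Matrix.vecMulVec_apply,
    ketS, Pi.star_apply, smul_eq_mul]
  by_cases h1 : i ∈ S
  · by_cases h2 : j ∈ S
    · have := hs _ h1
      simp only [h1, h2, if_true, RCLike.star_def, Complex.conj_ofReal]
      linear_combination -2 * this
    · simp [h1, h2]; ring
  · simp [h1]; ring

theorem card_mul_reflectionS_mem_subsetPoly (i j : Fin N) :
    (fun S => (S.card : ℂ) * reflectionS S i j) ∈ subsetPoly N 2 := by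
  simp only [card_mul_reflectionS_apply]
  have h1 := subsetPoly.mono (N := N) (d := 1) (e := 2) (by norm_num) subsetPoly.card_mem
  have h2 := subsetPoly.mul_mem (subsetPoly.indicator_mem i) (subsetPoly.indicator_mem j)
  exact (subsetPoly N 2).add_mem
    ((subsetPoly N 2).smul_mem ((1 : Matrix (Fin N) (Fin N) ℂ) i j) h1)
    ((subsetPoly N 2).smul_mem (-2) h2)

/-- The entries of a gate are polynomial in the membership indicators, up to a factor of `|S|` for
each reflection. -/
theorem Gate.toMatrix_mem_subsetPoly (g : Gate N r m) (z y : BasisIdx N r m) :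
    (fun S => (S.card : ℂ) ^ g.reflectCost * g.toMatrix S z y) ∈
      subsetPoly N (g.queryCost + 2 * g.reflectCost) := by
  have key : ∀ (a b : ℂ) {n : ℕ} {f : Finset (Fin N) → ℂ}, f ∈ subsetPoly N n →
      (fun S => a * (f S * b)) ∈ subsetPoly N n := fun a b n f hf => by
    convert (subsetPoly N n).smul_mem (a * b) hf using 1
    ext S; simp only [Pi.smul_apply, smul_eq_mul]; ring
  cases g with
  | free U => simpa [Gate.toMatrix, Gate.reflectCost] using subsetPoly.const_mem _
  | query =>
    simp only [Gate.reflectCost, Gate.queryCost, Gate.toMatrix, pow_zero, one_mul,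
      Matrix.kroneckerMap_apply, mul_zero, add_zero]
    refine key _ _ ?_
    simp only [membershipOracle, Matrix.diagonal_apply]
    by_cases h : z.2.1 = y.2.1
    · simp only [h, if_true]
      refine (subsetPoly N 1).sub_mem (subsetPoly.const_mem 1) ?_
      exact (subsetPoly N 1).smul_mem _ (subsetPoly.indicator_mem _)
    · simpa only [h, if_false] using subsetPoly.const_mem 0
  | reflect =>
    simp only [Gate.reflectCost, Gate.queryCost, Gate.toMatrix, pow_one,
      Matrix.kroneckerMap_apply, mul_one, zero_add]
    have h := card_mul_reflectionS_mem_subsetPoly z.2.1.1 y.2.1.1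
    generalize (1 : Matrix (Fin r → Fin N) (Fin r → Fin N) ℂ) z.1 y.1 = a₁
    generalize (1 : Matrix Bool Bool ℂ) z.2.1.2 y.2.1.2 = a₂
    generalize (1 : Matrix (Fin m) (Fin m) ℂ) z.2.2 y.2.2 = a₃
    refine Eq.mpr (congrArg (· ∈ subsetPoly N 2) (funext fun S => ?_)) (key a₁ (a₂ * a₃) h)
    ring

/-- A new amplitude is a sum of products of an old amplitude and a gate entry, so degrees add. The
prefactor `c` is arbitrary so that the induction can carry the normalization of the copies and the
powers of `|S|` from earlier reflections. -/
theorem foldl_gates_mem_subsetPoly (gates : List (Gate N r m)) {d : ℕ}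
    (ψ : Finset (Fin N) → BasisIdx N r m → ℂ) (c : Finset (Fin N) → ℂ)
    (hψ : ∀ z, (fun S => c S * ψ S z) ∈ subsetPoly N d) (z : BasisIdx N r m) :
    (fun S => c S * (S.card : ℂ) ^ (gates.map Gate.reflectCost).sum *
      gates.foldl (fun φ g => (g.toMatrix S).mulVec φ) (ψ S) z) ∈
      subsetPoly N (d + (gates.map Gate.queryCost).sum +
        2 * (gates.map Gate.reflectCost).sum) := by
  induction gates generalizing d ψ c with
  | nil => simpa using hψ z
  | cons g gates ih =>
    have h := ih (d := d + (g.queryCost + 2 * g.reflectCost))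
      (fun S => (g.toMatrix S).mulVec (ψ S))
      (fun S => c S * (S.card : ℂ) ^ g.reflectCost) fun z => by
        have : (∑ y, fun S => (c S * ψ S y) *
            ((S.card : ℂ) ^ g.reflectCost * g.toMatrix S z y)) ∈
            subsetPoly N (d + (g.queryCost + 2 * g.reflectCost)) :=
          Submodule.sum_mem _ fun y _ => subsetPoly.mul_mem (hψ y) (g.toMatrix_mem_subsetPoly z y)
        convert this using 1
        ext S
        rw [Finset.sum_apply, Matrix.mulVec, dotProduct, Finset.mul_sum]
        exact Finset.sum_congr rfl fun y _ => by ring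
    simp only [List.map_cons, List.sum_cons, List.foldl_cons]
    have hd : d + (g.queryCost + (gates.map Gate.queryCost).sum) +
        2 * (g.reflectCost + (gates.map Gate.reflectCost).sum) =
        d + (g.queryCost + 2 * g.reflectCost) + (gates.map Gate.queryCost).sum +
        2 * (gates.map Gate.reflectCost).sum := by ring
    rw [hd]
    convert h using 3 with S
    ring

theorem Matrix.sum_norm_sq_mulVec_of_mem_unitaryGroup {n : Type*} [Fintype n] [DecidableEq n]
    {M : Matrix n n ℂ} (hM : M ∈ Matrix.unitaryGroup n ℂ) (v : n → ℂ) :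
    ∑ z, ‖(M.mulVec v) z‖ ^ 2 = ∑ z, ‖v z‖ ^ 2 := by
  have h : ∀ u : n → ℂ, ((∑ z, ‖u z‖ ^ 2 : ℝ) : ℂ) = star u ⬝ᵥ u := fun u => by
    rw [dotProduct, Complex.ofReal_sum]
    refine Finset.sum_congr rfl fun z _ => ?_
    rw [Pi.star_apply, RCLike.star_def, Complex.conj_mul', Complex.ofReal_pow]
  apply Complex.ofReal_injective
  rw [h, h, Matrix.star_mulVec, Matrix.dotProduct_mulVec, Matrix.vecMul_vecMul,
    ← Matrix.star_eq_conjTranspose, Matrix.mem_unitaryGroup_iff'.1 hM, Matrix.vecMul_one]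

theorem sum_norm_sq_ketS {S : Finset (Fin N)} (hS : S.Nonempty) : ∑ i, ‖ketS S i‖ ^ 2 = 1 := by
  have hc : (0 : ℝ) < S.card := by exact_mod_cast hS.card_pos
  have : ∀ i, ‖ketS S i‖ ^ 2 = if i ∈ S then ((S.card : ℝ))⁻¹ else 0 := fun i => by
    unfold ketS
    split_ifs
    · rw [Complex.norm_real, Real.norm_eq_abs, sq_abs, div_pow, Real.sq_sqrt hc.le]; simp
    · simp
  simp only [this, Finset.sum_ite_mem, Finset.univ_inter, Finset.sum_const, nsmul_eq_mul]
  exact mul_inv_cancel₀ hc.ne'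

theorem reflectionS_mem_unitary {S : Finset (Fin N)} (hS : S.Nonempty) :
    reflectionS S ∈ unitary (Matrix (Fin N) (Fin N) ℂ) := by
  have hstar : star (reflectionS S) = reflectionS S := by
    rw [reflectionS, star_sub, star_one, star_smul, Matrix.star_eq_conjTranspose,
      Matrix.conjTranspose_vecMulVec, star_star]
    simp
  have hdot : star (ketS S) ⬝ᵥ ketS S = 1 := by
    rw [dotProduct, ← Complex.ofReal_one, ← sum_norm_sq_ketS hS, Complex.ofReal_sum]
    refine Finset.sum_congr rfl fun z _ => ?_
    rw [Pi.star_apply, RCLike.star_def, Complex.conj_mul', Complex.ofReal_pow]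
  have hsq : reflectionS S * reflectionS S = 1 := by
    have : Matrix.vecMulVec (ketS S) (star (ketS S)) * Matrix.vecMulVec (ketS S) (star (ketS S)) =
        Matrix.vecMulVec (ketS S) (star (ketS S)) := by
      rw [Matrix.vecMulVec_mul_vecMulVec, hdot]; simp
    rw [reflectionS, sub_mul, mul_sub, mul_sub, smul_mul_smul_comm, this, one_mul, one_mul, mul_one]
    module
  rw [Unitary.mem_iff, hstar]
  exact ⟨hsq, hsq⟩

theorem membershipOracle_mem_unitary (S : Finset (Fin N)) :
    membershipOracle S ∈ unitary (Matrix (Fin N × Bool) (Fin N × Bool) ℂ) := by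
  have hstar : star (membershipOracle S) = membershipOracle S := by
    rw [membershipOracle, Matrix.star_eq_conjTranspose, Matrix.diagonal_conjTranspose]
    congr 1
    ext q
    simp only [Pi.star_apply]
    split_ifs <;> simp
  have hsq : membershipOracle S * membershipOracle S = 1 := by
    rw [membershipOracle, Matrix.diagonal_mul_diagonal, ← Matrix.diagonal_one]
    congr 1
    ext q
    split_ifs <;> norm_num
  rw [Unitary.mem_iff, hstar]
  exact ⟨hsq, hsq⟩

theorem Gate.toMatrix_mem_unitaryGroup {S : Finset (Fin N)} (hS : S.Nonempty) (g : Gate N r m) :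
    g.toMatrix S ∈ Matrix.unitaryGroup (BasisIdx N r m) ℂ := by
  cases g with
  | free U => exact U.2
  | query =>
    exact Matrix.kronecker_mem_unitary (one_mem _)
      (Matrix.kronecker_mem_unitary (membershipOracle_mem_unitary S) (one_mem _))
  | reflect =>
    exact Matrix.kronecker_mem_unitary (one_mem _) (Matrix.kronecker_mem_unitary
      (Matrix.kronecker_mem_unitary (reflectionS_mem_unitary hS) (one_mem _)) (one_mem _))

theorem sum_norm_sq_foldl_gates {S : Finset (Fin N)} (hS : S.Nonempty)
    (gates : List (Gate N r m)) (ψ : BasisIdx N r m → ℂ) :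
    ∑ z, ‖gates.foldl (fun φ g => (g.toMatrix S).mulVec φ) ψ z‖ ^ 2 = ∑ z, ‖ψ z‖ ^ 2 := by
  induction gates generalizing ψ with
  | nil => rfl
  | cons g gates ih =>
    rw [List.foldl_cons, ih,
      Matrix.sum_norm_sq_mulVec_of_mem_unitaryGroup (g.toMatrix_mem_unitaryGroup hS)]

end Gates

/-! ### The mean acceptance probability as a Laurent polynomial -/

namespace QAlgorithm

variable {N : ℕ} (Q : QAlgorithm N)

theorem sum_norm_sq_initialState {S : Finset (Fin N)} (hS : S.Nonempty) :
    ∑ z, ‖Q.initialState S z‖ ^ 2 = 1 := by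
  rw [Fintype.sum_prod_type]
  have : ∀ x : Fin Q.copies → Fin N, ∑ y, ‖Q.initialState S (x, y)‖ ^ 2 =
      ∏ k, ‖ketS S (x k)‖ ^ 2 := fun x => by
    rw [Finset.sum_eq_single Q.init]
    · simp [initialState, norm_prod, Finset.prod_pow]
    · intro y _ hy
      simp [initialState, hy]
    · simp
  rw [Finset.sum_congr rfl fun x _ => this x, ← Fintype.prod_sum (fun (_ : Fin Q.copies) i => ‖ketS S i‖ ^ 2)]
  simp [sum_norm_sq_ketS hS]

theorem acceptProb_nonneg (S : Finset (Fin N)) : 0 ≤ Q.acceptProb S :=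
  Finset.sum_nonneg fun _ _ => by positivity

theorem acceptProb_le_one {S : Finset (Fin N)} (hS : S.Nonempty) : Q.acceptProb S ≤ 1 := by
  calc Q.acceptProb S ≤ ∑ z, ‖Q.finalState S z‖ ^ 2 :=
        Finset.sum_le_sum_of_subset_of_nonneg (Finset.subset_univ _) fun _ _ _ => by positivity
    _ = 1 := by
        rw [← Q.sum_norm_sq_initialState hS]
        exact sum_norm_sq_foldl_gates hS _ _

theorem initialState_mem_subsetPoly (z : BasisIdx N Q.copies Q.workDim) :
    (fun S => ((√(S.card : ℝ) : ℝ) : ℂ) ^ Q.copies * Q.initialState S z) ∈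
      subsetPoly N Q.copies := by
  have h := (subsetPoly N Q.copies).smul_mem (if z.2 = Q.init then (1 : ℂ) else 0)
    (subsetPoly.prod_indicator_mem z.1)
  convert h using 1
  ext S
  have hk : ∀ i, ((√(S.card : ℝ) : ℝ) : ℂ) * ketS S i = if i ∈ S then 1 else 0 := fun i => by
    unfold ketS
    split_ifs with hi
    · have : (0 : ℝ) < S.card := by exact_mod_cast Finset.card_pos.2 ⟨i, hi⟩
      rw [← Complex.ofReal_mul, mul_one_div_cancel (Real.sqrt_pos.2 this).ne', Complex.ofReal_one]
    · simp
  have hc : Q.copies = (Finset.univ : Finset (Fin Q.copies)).card := by simp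
  simp only [Pi.smul_apply, smul_eq_mul, initialState, ← hk, Finset.prod_mul_distrib,
    Finset.prod_const, ← hc]
  ring

theorem acceptProb_mem_subsetPoly :
    (fun S => (((S.card : ℝ) ^ (2 * (Q.copies + Q.reflections)) * Q.acceptProb S : ℝ) : ℂ)) ∈
      subsetPoly N (2 * (Q.copies + Q.reflections) +
        (2 * Q.queries + 2 * (Q.copies + Q.reflections))) := by
  have hamp := fun z => foldl_gates_mem_subsetPoly Q.gates Q.initialState _
    Q.initialState_mem_subsetPoly z
  -- An amplitude times its conjugate carries `|S| ^ (copies + 2 * reflections)`: the roots `√|S|`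
  -- pair up. The extra `|S| ^ copies` makes the exponent `2 * (copies + reflections)`, a function
  -- of `R` alone.
  have hsum := Submodule.sum_mem _ fun z (_ : z ∈ Q.accept) =>
    subsetPoly.mul_mem (subsetPoly.mul_mem (hamp z) (subsetPoly.star_mem (hamp z)))
      (subsetPoly.card_pow_mem Q.copies)
  refine subsetPoly.mono ?_ (Eq.mpr (congrArg (· ∈ _) ?_) hsum)
  · simp only [queries, reflections]; omega
  · ext S
    rw [Finset.sum_apply, acceptProb, Finset.mul_sum, Complex.ofReal_sum]
    refine Finset.sum_congr rfl fun z _ => ?_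
    have hsq : ((√(S.card : ℝ) : ℝ) : ℂ) * ((√(S.card : ℝ) : ℝ) : ℂ) = S.card := by
      rw [← Complex.ofReal_mul, Real.mul_self_sqrt (by positivity), Complex.ofReal_natCast]
    have hn : ((‖Q.finalState S z‖ ^ 2 : ℝ) : ℂ) =
        Q.finalState S z * star (Q.finalState S z) := by
      rw [RCLike.star_def, Complex.mul_conj', Complex.ofReal_pow]
    rw [Complex.ofReal_mul, hn, Complex.ofReal_pow, Complex.ofReal_natCast]
    change _ = ((√(S.card : ℝ) : ℝ) : ℂ) ^ Q.copies * (S.card : ℂ) ^ Q.reflections *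
      Q.finalState S z * star (((√(S.card : ℝ) : ℝ) : ℂ) ^ Q.copies *
        (S.card : ℂ) ^ Q.reflections * Q.finalState S z) * (S.card : ℂ) ^ Q.copies
    simp only [star_mul', star_pow, RCLike.star_def, Complex.conj_ofReal, Complex.conj_natCast]
    have hsq' : ((√(S.card : ℝ) : ℝ) : ℂ) ^ Q.copies * ((√(S.card : ℝ) : ℝ) : ℂ) ^ Q.copies =
        (S.card : ℂ) ^ Q.copies := by rw [← mul_pow, hsq]
    rw [show 2 * (Q.copies + Q.reflections) = Q.copies + Q.copies + Q.reflections + Q.reflections by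
      ring, pow_add, pow_add, pow_add]
    linear_combination (-(S.card : ℂ) ^ Q.copies * (S.card : ℂ) ^ Q.reflections *
      (S.card : ℂ) ^ Q.reflections * Q.finalState S z *
      (starRingEnd ℂ) (Q.finalState S z)) * hsq'

/-- The acceptance probability on a uniformly random subset of size `k`. -/
noncomputable def meanAcceptProb (k : ℕ) : ℝ :=
  (∑ S ∈ Finset.powersetCard k Finset.univ, Q.acceptProb S) / N.choose k

theorem le_meanAcceptProb {k : ℕ} (hk : k ≤ N) {a : ℝ}
    (h : ∀ S : Finset (Fin N), S.card = k → a ≤ Q.acceptProb S) : a ≤ Q.meanAcceptProb k := by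
  have : (0 : ℝ) < N.choose k := by exact_mod_cast Nat.choose_pos hk
  rw [meanAcceptProb, le_div_iff₀ this]
  have := Finset.card_nsmul_le_sum (Finset.powersetCard k Finset.univ) Q.acceptProb a
    fun S hS => h S (Finset.mem_powersetCard.1 hS).2
  simpa [mul_comm] using this

theorem meanAcceptProb_le {k : ℕ} (hk : k ≤ N) {a : ℝ}
    (h : ∀ S : Finset (Fin N), S.card = k → Q.acceptProb S ≤ a) : Q.meanAcceptProb k ≤ a := by
  have : (0 : ℝ) < N.choose k := by exact_mod_cast Nat.choose_pos hk
  rw [meanAcceptProb, div_le_iff₀ this]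
  have := Finset.sum_le_card_nsmul (Finset.powersetCard k Finset.univ) Q.acceptProb a
    fun S hS => h S (Finset.mem_powersetCard.1 hS).2
  simpa [mul_comm] using this

-- On sets of size `k` the power of `|S|` is constant and leaves the average. The degree bound is
-- written as `E + D`, the form used by `laurent_sub_le`.
open Polynomial in
theorem exists_polynomial_meanAcceptProb :
    ∃ P : ℝ[X], P.natDegree ≤ 2 * (Q.copies + Q.reflections) +
        (2 * Q.queries + 2 * (Q.copies + Q.reflections)) ∧
      ∀ k ≤ N, (k : ℝ) ^ (2 * (Q.copies + Q.reflections)) * Q.meanAcceptProb k =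
        P.eval (k : ℝ) := by
  obtain ⟨P, hP, h⟩ := subsetPoly.exists_real_polynomial_average Q.acceptProb_mem_subsetPoly
  refine ⟨P, hP, fun k hk => ?_⟩
  have hpos : (0 : ℝ) < N.choose k := by exact_mod_cast Nat.choose_pos hk
  rw [meanAcceptProb, ← mul_div_assoc, div_eq_iff hpos.ne', mul_comm (P.eval _), ← h k hk,
    Finset.mul_sum]
  exact Finset.sum_congr rfl fun S hS => by rw [(Finset.mem_powersetCard.1 hS).2]

end QAlgorithm

/-! ### Choice of constants and conclusion -/

theorem theorem1p3 (p : ℝ) (hp : 1 / 2 < p) :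
    ∃ c : ℝ, 0 < c ∧ ∀ N w : ℕ, 1 ≤ w → 2 * w ≤ N →
      ∀ (Q : QAlgorithm N) (T R : ℕ), Q.queries = T → Q.copies + Q.reflections = R →
        Q.Decides w p →
          c * √((N : ℝ) / (w : ℝ)) ≤ (T : ℝ) ∨
          c * min ((w : ℝ) ^ ((1 : ℝ) / 3)) (√((N : ℝ) / (w : ℝ))) ≤ (R : ℝ) := by
  -- The low and the high nodes will each contribute at most `8 / C`, and `16 / C < 2p - 1`
  -- contradicts the gap between acceptance at `w` and at `2w`.
  obtain ⟨C₀, hC₀⟩ := exists_nat_gt (16 / (2 * p - 1))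
  set C : ℕ := max C₀ 4 with hCdef
  have hC4 : 4 ≤ C := le_max_right _ _
  have hC4' : (4 : ℝ) ≤ C := by exact_mod_cast hC4
  have hε : 0 < 2 * p - 1 := by linarith
  have hC : 16 / (2 * p - 1) < C := lt_of_lt_of_le hC₀ (by exact_mod_cast le_max_left _ _)
  have hCε : 8 / (C : ℝ) < (2 * p - 1) / 2 := by
    rw [div_lt_iff₀ hε] at hC
    rw [div_lt_iff₀ (by linarith)]
    linarith
  set c : ℝ := 1 / (16 * C) with hc
  have hc0 : 0 < c := by positivity
  have hcC : c * C = 1 / 16 := by rw [hc]; field_simp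
  have hc1 : c ≤ 1 / 64 := by nlinarith
  refine ⟨c, hc0, fun N w hw hN Q T R hT hR ⟨hrej, hacc⟩ => ?_⟩
  by_contra! hcon
  obtain ⟨hTlt, hRlt⟩ := hcon
  have hw' : (0 : ℝ) < w := by exact_mod_cast hw
  set s : ℝ := √((N : ℝ) / w) with hs
  have hs0 : 0 ≤ s := Real.sqrt_nonneg _
  have hs2 : s ^ 2 * w = N := by
    rw [hs, Real.sq_sqrt (by positivity), div_mul_cancel₀ _ hw'.ne']
  set t : ℝ := (w : ℝ) ^ ((1 : ℝ) / 3) with ht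
  have ht0 : 0 < t := by positivity
  have ht3 : t ^ 3 = w := by
    rw [ht, ← Real.rpow_natCast, ← Real.rpow_mul hw'.le]; norm_num
  have hRt : (R : ℝ) < c * t := hRlt.trans_le (by gcongr; exact min_le_left _ _)
  have hRs : (R : ℝ) < c * s := hRlt.trans_le (by gcongr; exact min_le_right _ _)
  have hR3 : (R : ℝ) ^ 3 ≤ c ^ 3 * w := by
    rw [← ht3, ← mul_pow]; gcongr
  have hc3 : c ^ 3 ≤ c / 64 ^ 2 := by
    have : c ^ 2 ≤ (1 / 64) ^ 2 := by gcongr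
    calc c ^ 3 = c * c ^ 2 := by ring
      _ ≤ c * (1 / 64) ^ 2 := by gcongr
      _ = _ := by ring
  -- Since `D = 2T + 2R ≤ 4cs`, the last high node is at most `16c · (cC) · N = c N`, which is below
  -- `N`.
  have hD : C * (2 * T + 2 * R) ^ 2 * w ≤ N := by
    have h1 : (2 * T + 2 * R : ℝ) ≤ 4 * c * s := by linarith
    have : (C * (2 * T + 2 * R : ℝ) ^ 2 * w : ℝ) ≤ N := by
      calc (C * (2 * T + 2 * R : ℝ) ^ 2 * w : ℝ) ≤ C * (4 * c * s) ^ 2 * w := by gcongr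
        _ = (c * C) * (16 * c) * (s ^ 2 * w) := by ring
        _ ≤ 1 * N := by
          rw [hs2, hcC]
          gcongr
          linarith
        _ = N := one_mul _
    exact_mod_cast this
  have hE : 2 * (2 * R) ^ 3 < w := by
    have : (2 * (2 * R : ℝ) ^ 3 : ℝ) < w := by
      have : c ^ 3 * w ≤ 1 / 64 ^ 3 * w := by gcongr; linarith
      nlinarith
    exact_mod_cast this
  obtain ⟨P, hP, hq⟩ := Q.exists_polynomial_meanAcceptProb
  rw [hR, hT] at hP
  rw [hR] at hq
  have hgap := laurent_sub_le hC4 hw hN hD hE hP (fun k _ hk => hq k hk)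
    (fun k _ hk => Q.le_meanAcceptProb hk fun S _ => Q.acceptProb_nonneg S)
    (fun k hk1 hk => Q.meanAcceptProb_le hk fun S hS =>
      Q.acceptProb_le_one (Finset.card_pos.1 (by omega)))
  have h1 : Q.meanAcceptProb w ≤ 1 - p :=
    Q.meanAcceptProb_le (by omega) fun S hS => by linarith [hrej S hS]
  have h2 : p ≤ Q.meanAcceptProb (2 * w) := Q.le_meanAcceptProb hN hacc
  -- From `R³ ≤ c³ w`, spending two factors `c ≤ 1 / 64` and using the third for `c C = 1 / 16`.
  have h3 : 8 * ((2 * R : ℕ) : ℝ) ^ 3 / w ≤ 8 / C := by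
    rw [div_le_div_iff₀ hw' (by linarith)]
    push_cast
    calc 8 * (2 * (R : ℝ)) ^ 3 * C = 64 * C * (R : ℝ) ^ 3 := by ring
      _ ≤ 64 * C * (c / 64 ^ 2 * w) := by
        gcongr
        exact hR3.trans (by gcongr)
      _ = 64 / 64 ^ 2 * (c * C) * w := by ring
      _ ≤ 8 * w := by
        rw [hcC]
        gcongr
        norm_num
  linarith
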